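/- Let $\mathbb{D}=\{z\in\mathbb{C}:|z|<1\}$. Let $H^2(\mathbb{D})$ be the Hardy space of analytic functions $g$ on $\mathbb{D}$ with $\|g\|^2=\sup_{0\le r<1}\frac1{2\pi}\int_{-\pi}^{\pi}|g(re^{i\theta})|^2\,d\theta<\infty$, and let $H^\infty(\mathbb{D})$ be the Banach algebra of bounded analytic functions on $\mathbb{D}$. For $\varphi\in H^\infty(\mathbb{D})$ let $M_\varphi g=\varphi g$ be the multiplication operator on $H^2(\mathbb{D})$ and $M_\varphi^*$ its Hilbert space adjoint. For a connected open set $\Omega\subseteq\mathbb{C}$ and an integer $n\ge 1$, a bounded operator $T$ on a Hilbert space $H$ belongs to $\mathcal{B}_n(\Omega)$ if $\Omega\subseteq\sigma(T)$, $\operatorname{ran}(T-\omega)=H$ for all $\omega\in\Omega$, the closed linear span of $\bigcup_{\omega\in\Omega}\ker(T-\omega)$ is $H$, and $\dim\ker(T-\omega)=n$ for all $\omega\in\Omega$. The function $\varphi\in H^\infty(\mathbb{D})$ is called a Cowen-Douglas function if $M_\varphi^*\in\mathcal{B}_n(\Omega)$ for some $n\ge1$, where $\Omega=\{\overline{\varphi(z)}:z\in\mathbb{D}\}$.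 A bounded operator $T$ on a Banach space $X$ is called - Devaney chaotic if it is topologically transitive (for all non-empty open $U,V\subseteq X$ there is $n\in\mathbb{N}$ with $T^n(U)\cap V\neq\emptyset$), its periodic points are dense in $X$, and it has sensitive dependence on initial conditions (there is $\delta>0$ such that for all $x\in X$ and $\varepsilon>0$ there are $y\in X$ with $\|x-y\|<\varepsilon$ and $n\in\mathbb{N}$ with $\|T^nx-T^ny\|>\delta$); - distributionally chaotic if there is $x\in X$ such that, with $F_x^n(\tau)=\frac1n\#\{0\le i\le n:\|T^ix\|<\tau\}$, one has $\liminf_{n\to\infty}F_x^n(\tau)=0$ for some $\tau>0$ and $\limsup_{n\to\infty}F_x^n(\varepsilon)=1$ for all $\varepsilon>0$; - strongly mixing if for all non-empty open $U,V\subseteq X$ there is $N$ with $T^n(U)\cap V\neq\emptyset$ for all $n\ge N$; - Li-Yorke chaotic if there is $x\in X$ with $\limsup_{n\to\infty}\|T^nx\|>0$ (possibly $+\infty$) and $\liminf_{n\to\infty}\|T^nx\|=0$. Corollary 5. Let $\varphi\in H^\infty(\mathbb{D})$ be a Cowen-Douglas function that is invertible in the algebra $H^\infty(\mathbb{D})$.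 Then $M_\varphi^*$ is invertible, and: $M_\varphi^*$ is Devaney chaotic if and only if $(M_\varphi^*)^{-1}$ is Devaney chaotic; $M_\varphi^*$ is distributionally chaotic if and only if $(M_\varphi^*)^{-1}$ is distributionally chaotic; $M_\varphi^*$ is strongly mixing if and only if $(M_\varphi^*)^{-1}$ is strongly mixing; and $M_\varphi^*$ is Li-Yorke chaotic if and only if $(M_\varphi^*)^{-1}$ is Li-Yorke chaotic. -/

import Mathlib

open scoped ComplexConjugate Complex.UnitDisc

noncomputable section

theorem hasSum_of_eq {E : Type*} [AddCommMonoid E] [TopologicalSpace E] {f g : ℕ → E} {a : E}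
    (hg : HasSum g a) (h : ∀ n, f n = g n) : HasSum f a := by
  rwa [funext h]

theorem hasFPowerSeriesOnBall_of_hasSum {F : ℂ → ℂ} {a : ℕ → ℂ}
    (h : ∀ z : ℂ, ‖z‖ < 1 → HasSum (fun n => a n * z ^ n) (F z)) :
    HasFPowerSeriesOnBall F (FormalMultilinearSeries.ofScalars ℂ a) 0 1 where
  r_le := by
    refine ENNReal.le_of_forall_nnreal_lt fun r hr => ?_
    refine FormalMultilinearSeries.le_radius_of_summable_norm _ ?_
    have hr1 : (r : ℝ) < 1 := by exact_mod_cast hr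
    have hs := (h (r : ℂ) (by simpa using hr1)).summable.norm
    simpa using hs
  r_pos := one_pos
  hasSum := by
    intro y hy
    have hy1 : ‖y‖ < 1 := by simpa [← ENNReal.coe_one, Metric.eball_coe] using hy
    simpa [FormalMultilinearSeries.ofScalars_apply_eq, mul_comm] using h y hy1

theorem differentiableOn_of_hasSum {F : ℂ → ℂ} {a : ℕ → ℂ}
    (h : ∀ z : ℂ, ‖z‖ < 1 → HasSum (fun n => a n * z ^ n) (F z)) :
    DifferentiableOn ℂ F (Metric.ball 0 1) := by
  have := (hasFPowerSeriesOnBall_of_hasSum h).differentiableOn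
  rwa [← ENNReal.coe_one, Metric.eball_coe] at this

theorem coeff_unique {F : ℂ → ℂ} {a b : ℕ → ℂ}
    (ha : ∀ z : ℂ, ‖z‖ < 1 → HasSum (fun n => a n * z ^ n) (F z))
    (hb : ∀ z : ℂ, ‖z‖ < 1 → HasSum (fun n => b n * z ^ n) (F z)) : a = b :=
  FormalMultilinearSeries.ofScalars_series_injective ℂ ℂ
    ((hasFPowerSeriesOnBall_of_hasSum ha).hasFPowerSeriesAt.eq_formalMultilinearSeries
      (hasFPowerSeriesOnBall_of_hasSum hb).hasFPowerSeriesAt)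

theorem hasSum_coeff {F : ℂ → ℂ} (hF : DifferentiableOn ℂ F (Metric.ball 0 1)) :
    ∀ z : ℂ, ‖z‖ < 1 → HasSum (fun n : ℕ => iteratedDeriv n F 0 / (n.factorial : ℂ) * z ^ n) (F z) := by
  intro z hz
  have := Complex.hasSum_taylorSeries_on_ball hF (z := z) (by simpa using hz)
  refine hasSum_of_eq this fun n => ?_
  simp only [sub_zero, smul_eq_mul]
  ring

theorem integral_exp_orth (m n : ℕ) :
    ∫ θ in (0 : ℝ)..2 * Real.pi, Complex.exp (θ * Complex.I) ^ m
      * conj (Complex.exp (θ * Complex.I) ^ n) = if m = n then (2 * Real.pi : ℂ) else 0 := by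
  have key : ∀ θ : ℝ, Complex.exp (θ * Complex.I) ^ m * conj (Complex.exp (θ * Complex.I) ^ n)
      = Complex.exp ((((m : ℤ) - (n : ℤ) : ℤ) * Complex.I) * θ) := by
    intro θ
    rw [map_pow, ← Complex.exp_conj, ← Complex.exp_nat_mul, ← Complex.exp_nat_mul,
      ← Complex.exp_add]
    congr 1
    simp
    ring
  simp_rw [key]
  split_ifs with h
  · subst h; simp
  · have hne : ((m : ℤ) - (n : ℤ) : ℤ) ≠ 0 := by omega
    rw [integral_exp_mul_complex (mul_ne_zero (by exact_mod_cast hne) Complex.I_ne_zero)]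
    have h1 : Complex.exp ((((m : ℤ) - (n : ℤ) : ℤ) * Complex.I) * ((2 * Real.pi : ℝ) : ℂ)) = 1 := by
      rw [← Complex.exp_int_mul_two_pi_mul_I ((m : ℤ) - (n : ℤ))]
      congr 1
      push_cast
      ring
    rw [h1]
    simp

theorem parseval {F : ℂ → ℂ} {a : ℕ → ℂ}
    (h : ∀ z : ℂ, ‖z‖ < 1 → HasSum (fun n => a n * z ^ n) (F z)) {r : ℝ} (hr0 : 0 ≤ r)
    (hr1 : r < 1) :
    HasSum (fun n => ‖a n‖ ^ 2 * r ^ (2 * n))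
      (Real.circleAverage (fun z => ‖F z‖ ^ 2) 0 r) := by
  set E : ℝ → ℂ := fun θ => Complex.exp (θ * Complex.I) with hE
  have hEn : ∀ θ, ‖E θ‖ = 1 := fun θ => Complex.norm_exp_ofReal_mul_I θ
  have hEc : Continuous E := by fun_prop
  set c : ℕ → ℂ := fun n => a n * (r : ℂ) ^ n with hc
  have hcs : Summable fun n => ‖c n‖ :=
    (h (r : ℂ) (by simpa [abs_of_nonneg hr0] using hr1)).summable.norm
  have hcm : ∀ θ, circleMap 0 r θ = r * E θ := fun θ => by simp [circleMap, hE]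
  have hcn : ∀ θ, ‖circleMap 0 r θ‖ < 1 := fun θ => by
    rw [hcm, norm_mul, hEn]; simpa [abs_of_nonneg hr0] using hr1
  set g : ℝ → ℂ := fun θ => F (circleMap 0 r θ) with hg
  have hgc : Continuous g := by
    refine (differentiableOn_of_hasSum h).continuousOn.comp_continuous
      (continuous_circleMap 0 r) fun θ => ?_
    simpa using hcn θ
  have hgs : ∀ θ, HasSum (fun n => c n * E θ ^ n) (g θ) := fun θ => by
    have := h _ (hcn θ)
    convert this using 2 with n
    rw [hcm, mul_pow, hc]; ring
  have hgb : ∀ θ, ‖g θ‖ ≤ ∑' n, ‖c n‖ := fun θ => by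
    rw [← (hgs θ).tsum_eq]
    refine (norm_tsum_le_tsum_norm ?_).trans_eq ?_
    · simpa [hEn] using hcs
    · simp [hEn]
  have step1 : ∀ n : ℕ, ∫ θ in (0 : ℝ)..2 * Real.pi, g θ * conj (E θ ^ n)
      = 2 * Real.pi * c n := by
    intro n
    have hs : HasSum (fun m => ∫ θ in (0 : ℝ)..2 * Real.pi, c m * E θ ^ m * conj (E θ ^ n))
        (∫ θ in (0 : ℝ)..2 * Real.pi, g θ * conj (E θ ^ n)) := by
      refine intervalIntegral.hasSum_integral_of_dominated_convergence
        (fun m _ => ‖c m‖) (fun m => ?_) (fun m => ?_) ?_ ?_ ?_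
      · exact Continuous.aestronglyMeasurable (by fun_prop)
      · refine Filter.Eventually.of_forall fun θ _ => ?_
        simp [hEn]
      · exact Filter.Eventually.of_forall fun θ _ => hcs
      · exact intervalIntegrable_const
      · exact Filter.Eventually.of_forall fun θ _ => (hgs θ).mul_right _
    have hterm : ∀ m, ∫ θ in (0 : ℝ)..2 * Real.pi, c m * E θ ^ m * conj (E θ ^ n)
        = if m = n then 2 * Real.pi * c n else 0 := by
      intro m
      simp_rw [mul_assoc]
      rw [intervalIntegral.integral_const_mul, integral_exp_orth]
      split_ifs with hmn
      · subst hmn; ring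
      · simp
    simp_rw [hterm] at hs
    exact hs.unique (hasSum_ite_eq n _)
  have step2 : HasSum (fun n => ((2 * Real.pi * ‖c n‖ ^ 2 : ℝ) : ℂ))
      (∫ θ in (0 : ℝ)..2 * Real.pi, g θ * conj (g θ)) := by
    have hs : HasSum (fun n => ∫ θ in (0 : ℝ)..2 * Real.pi, g θ * conj (c n * E θ ^ n))
        (∫ θ in (0 : ℝ)..2 * Real.pi, g θ * conj (g θ)) := by
      refine intervalIntegral.hasSum_integral_of_dominated_convergence
        (fun n _ => (∑' n, ‖c n‖) * ‖c n‖) (fun m => ?_) (fun m => ?_) ?_ ?_ ?_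
      · exact Continuous.aestronglyMeasurable (by fun_prop)
      · refine Filter.Eventually.of_forall fun θ _ => ?_
        rw [norm_mul, RCLike.norm_conj, norm_mul, norm_pow, hEn, one_pow, mul_one]
        exact mul_le_mul_of_nonneg_right (hgb θ) (norm_nonneg _)
      · exact Filter.Eventually.of_forall fun θ _ => hcs.mul_left _
      · exact intervalIntegrable_const
      · exact Filter.Eventually.of_forall fun θ _ =>
          ((Complex.hasSum_conj'.2 (by simpa using hgs θ))).mul_left _
    convert hs using 2 with n
    have : ∀ θ, g θ * conj (c n * E θ ^ n) = conj (c n) * (g θ * conj (E θ ^ n)) := fun θ => by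
      rw [map_mul]; ring
    simp_rw [this]
    rw [intervalIntegral.integral_const_mul, step1]
    push_cast
    rw [← Complex.mul_conj' (c n)]
    ring
  have step3 : ∫ θ in (0 : ℝ)..2 * Real.pi, g θ * conj (g θ)
      = ((∫ θ in (0 : ℝ)..2 * Real.pi, ‖g θ‖ ^ 2 : ℝ) : ℂ) := by
    rw [← intervalIntegral.integral_ofReal]
    simp_rw [Complex.mul_conj']
    push_cast
    rfl
  rw [step3] at step2
  have step4 := (Complex.hasSum_ofReal.1 step2).mul_left (2 * Real.pi)⁻¹
  rw [Real.circleAverage, smul_eq_mul]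
  refine hasSum_of_eq step4 fun n => ?_
  simp only [hc]
  rw [norm_mul, norm_pow, Complex.norm_real, Real.norm_of_nonneg hr0, pow_mul']
  have := Real.pi_pos.ne'
  field_simp

theorem summable_of_means_le {F : ℂ → ℂ} {a : ℕ → ℂ}
    (h : ∀ z : ℂ, ‖z‖ < 1 → HasSum (fun n => a n * z ^ n) (F z)) {C : ℝ}
    (hC : ∀ r : ℝ, 0 ≤ r → r < 1 → Real.circleAverage (fun z => ‖F z‖ ^ 2) 0 r ≤ C) (s : Finset ℕ) :
    ∑ n ∈ s, ‖a n‖ ^ 2 ≤ C := by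
  have hle : ∀ r ∈ Set.Ioo (0 : ℝ) 1, ∑ n ∈ s, ‖a n‖ ^ 2 * r ^ (2 * n) ≤ C := fun r hr =>
    (sum_le_hasSum s (fun n _ => by have := hr.1; positivity) (parseval h hr.1.le hr.2)).trans
      (hC r hr.1.le hr.2)
  have hcont : Continuous fun r : ℝ => ∑ n ∈ s, ‖a n‖ ^ 2 * r ^ (2 * n) := by fun_prop
  have hcl : (1 : ℝ) ∈ closure (Set.Ioo (0 : ℝ) 1) := by
    rw [closure_Ioo (by norm_num)]; simp
  have : (1 : ℝ) ∈ {r : ℝ | ∑ n ∈ s, ‖a n‖ ^ 2 * r ^ (2 * n) ≤ C} :=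
    closure_minimal (fun r hr => hle r hr) (isClosed_le hcont continuous_const) hcl
  simpa using this

theorem means_le_tsum {F : ℂ → ℂ} {a : ℕ → ℂ}
    (h : ∀ z : ℂ, ‖z‖ < 1 → HasSum (fun n => a n * z ^ n) (F z))
    (hs : Summable fun n => ‖a n‖ ^ 2) {r : ℝ} (hr0 : 0 ≤ r) (hr1 : r < 1) :
    Real.circleAverage (fun z => ‖F z‖ ^ 2) 0 r ≤ ∑' n, ‖a n‖ ^ 2 := by
  refine hasSum_le (fun n => ?_) (parseval h hr0 hr1) hs.hasSum
  exact mul_le_of_le_one_right (by positivity) (pow_le_one₀ hr0 hr1.le)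

/-- A function on the open unit disc, extended by zero to the whole plane. -/
def discExt (f : 𝔻 → ℂ) (z : ℂ) : ℂ := if h : ‖z‖ < 1 then f (Complex.UnitDisc.mk z h) else 0

/-- `f` is complex analytic on the open unit disc. -/
def DiscAnalytic (f : 𝔻 → ℂ) : Prop := DifferentiableOn ℂ (discExt f) (Metric.ball 0 1)

/-- The integral mean `(1 / 2π) ∫ |f (r e ^ {iθ})| ^ 2 dθ` over a period. -/
def integralMean (f : 𝔻 → ℂ) (r : ℝ) : ℝ := Real.circleAverage (fun z => ‖discExt f z‖ ^ 2) 0 r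

theorem discExt_coe (f : 𝔻 → ℂ) (z : 𝔻) : discExt f z = f z := by
  simp [discExt, z.norm_lt_one]

theorem discExt_add (f g : 𝔻 → ℂ) : discExt (f + g) = discExt f + discExt g := by
  funext z; by_cases h : ‖z‖ < 1 <;> simp [discExt, h]

theorem discExt_smul (c : ℂ) (f : 𝔻 → ℂ) : discExt (c • f) = c • discExt f := by
  funext z; by_cases h : ‖z‖ < 1 <;> simp [discExt, h]

theorem discExt_mul (f g : 𝔻 → ℂ) : discExt (f * g) = discExt f * discExt g := by
  funext z; by_cases h : ‖z‖ < 1 <;> simp [discExt, h]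

theorem discExt_zero : discExt 0 = 0 := by
  funext z; simp [discExt]

theorem DiscAnalytic.add {f g : 𝔻 → ℂ} (hf : DiscAnalytic f) (hg : DiscAnalytic g) :
    DiscAnalytic (f + g) := by
  rw [DiscAnalytic, discExt_add]; exact DifferentiableOn.add hf hg

theorem DiscAnalytic.mul {f g : 𝔻 → ℂ} (hf : DiscAnalytic f) (hg : DiscAnalytic g) :
    DiscAnalytic (f * g) := by
  rw [DiscAnalytic, discExt_mul]; exact DifferentiableOn.mul hf hg

theorem DiscAnalytic.const_smul {f : 𝔻 → ℂ} (c : ℂ) (hf : DiscAnalytic f) :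
    DiscAnalytic (c • f) := by
  rw [DiscAnalytic, discExt_smul]; exact DifferentiableOn.const_smul hf c

theorem discAnalytic_const (c : ℂ) : DiscAnalytic (fun _ => c) := by
  refine (differentiableOn_const c).congr fun z hz => ?_
  simp [discExt, mem_ball_zero_iff.1 hz]

theorem DiscAnalytic.circleIntegrable {f : 𝔻 → ℂ} (hf : DiscAnalytic f) {r : ℝ} (hr0 : 0 ≤ r)
    (hr1 : r < 1) : CircleIntegrable (fun z => ‖discExt f z‖ ^ 2) 0 r := by
  refine ContinuousOn.circleIntegrable hr0 (ContinuousOn.pow (ContinuousOn.norm ?_) 2)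
  refine ContinuousOn.mono (DifferentiableOn.continuousOn hf) fun z hz => ?_
  rw [mem_sphere_zero_iff_norm] at hz
  simpa [hz] using hr1

/-- The Taylor coefficients at the origin. -/
def discCoeff (f : 𝔻 → ℂ) (n : ℕ) : ℂ := iteratedDeriv n (discExt f) 0 / (n.factorial : ℂ)

theorem DiscAnalytic.hasSum {f : 𝔻 → ℂ} (hf : DiscAnalytic f) (z : ℂ) (hz : ‖z‖ < 1) :
    HasSum (fun n => discCoeff f n * z ^ n) (discExt f z) := hasSum_coeff hf z hz

/-- The analytic functions on the disc whose integral means are bounded for `0 ≤ r < 1`. -/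
def hardySubmodule : Submodule ℂ (𝔻 → ℂ) where
  carrier := {f | DiscAnalytic f ∧ ∃ C : ℝ, ∀ r : ℝ, 0 ≤ r → r < 1 → integralMean f r ≤ C}
  zero_mem' := ⟨discAnalytic_const 0, 0, fun r _ _ => by
    simp [integralMean, discExt_zero, Real.circleAverage]⟩
  add_mem' := by
    rintro f g ⟨hf, C, hC⟩ ⟨hg, D, hD⟩
    refine ⟨hf.add hg, 2 * C + 2 * D, fun r hr0 hr1 => ?_⟩
    have h1 : integralMean (f + g) r ≤ 2 • integralMean f r + 2 • integralMean g r := by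
      simp only [two_nsmul]
      unfold integralMean
      have If := hf.circleIntegrable hr0 hr1
      have Ig := hg.circleIntegrable hr0 hr1
      rw [← Real.circleAverage_add If If, ← Real.circleAverage_add Ig Ig,
        ← Real.circleAverage_add (If.add If) (Ig.add Ig)]
      refine Real.circleAverage_mono ((hf.add hg).circleIntegrable hr0 hr1)
        ((If.add If).add (Ig.add Ig)) fun z _ => ?_
      simp only [discExt_add, Pi.add_apply]
      have := norm_add_le (discExt f z) (discExt g z)
      nlinarith [norm_nonneg (discExt f z + discExt g z), norm_nonneg (discExt f z),
        norm_nonneg (discExt g z), sq_nonneg (‖discExt f z‖ - ‖discExt g z‖)]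
    simp only [nsmul_eq_mul, Nat.cast_ofNat] at h1
    linarith [hC r hr0 hr1, hD r hr0 hr1]
  smul_mem' := by
    rintro c f ⟨hf, C, hC⟩
    refine ⟨hf.const_smul c, ‖c‖ ^ 2 * C, fun r hr0 hr1 => ?_⟩
    have : integralMean (c • f) r = ‖c‖ ^ 2 * integralMean f r := by
      simp only [integralMean, discExt_smul, Pi.smul_apply, norm_smul, mul_pow]
      rw [← smul_eq_mul, ← Real.circleAverage_fun_smul]
      rfl
    rw [this]
    exact mul_le_mul_of_nonneg_left (hC r hr0 hr1) (by positivity)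

/-- The Hardy space `H²` of the unit disc. -/
def HardySpace : Type := hardySubmodule

namespace HardySpace

instance : AddCommGroup HardySpace := inferInstanceAs (AddCommGroup hardySubmodule)

instance : Module ℂ HardySpace := inferInstanceAs (Module ℂ hardySubmodule)

/-- The underlying function on the disc. -/
def toFun (f : HardySpace) : 𝔻 → ℂ := f.1

instance : CoeFun HardySpace fun _ => 𝔻 → ℂ := ⟨toFun⟩

theorem ext_fun {f g : HardySpace} (h : ∀ z, f z = g z) : f = g := Subtype.ext (funext h)

theorem analytic (f : HardySpace) : DiscAnalytic f := f.2.1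

@[simp] theorem add_apply (f g : HardySpace) (z : 𝔻) : (f + g) z = f z + g z := rfl

@[simp] theorem smul_apply (c : ℂ) (f : HardySpace) (z : 𝔻) : (c • f) z = c * f z := rfl

theorem coeff_add (f g : HardySpace) : discCoeff (f + g : HardySpace) = discCoeff f + discCoeff g := by
  refine coeff_unique (f + g).analytic.hasSum fun z hz => ?_
  have : discExt (f + g : HardySpace) = discExt f + discExt g := discExt_add f g
  rw [this]
  refine hasSum_of_eq ((f.analytic.hasSum z hz).add (g.analytic.hasSum z hz)) fun n => ?_
  simp only [Pi.add_apply]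
  ring

theorem coeff_smul (c : ℂ) (f : HardySpace) : discCoeff (c • f : HardySpace) = c • discCoeff f := by
  refine coeff_unique (c • f).analytic.hasSum fun z hz => ?_
  have : discExt (c • f : HardySpace) = c • discExt f := discExt_smul c f
  rw [this]
  refine hasSum_of_eq ((f.analytic.hasSum z hz).mul_left c) fun n => ?_
  simp only [Pi.smul_apply, smul_eq_mul]
  ring

theorem summable_coeff (f : HardySpace) : Summable fun n => ‖discCoeff f n‖ ^ 2 := by
  obtain ⟨C, hC⟩ := f.2.2
  exact summable_of_sum_le (fun n => by positivity) (summable_of_means_le f.analytic.hasSum hC)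

/-- The sequence of Taylor coefficients, an element of `ℓ²`. -/
def toL2 : HardySpace →ₗ[ℂ] lp (fun _ : ℕ => ℂ) 2 where
  toFun f := ⟨discCoeff f, memℓp_gen (by simpa using f.summable_coeff)⟩
  map_add' f g := Subtype.ext (coeff_add f g)
  map_smul' c f := Subtype.ext (coeff_smul c f)

theorem norm_toL2_sq (f : HardySpace) : ‖toL2 f‖ ^ 2 = ∑' n, ‖discCoeff f n‖ ^ 2 := by
  have := lp.norm_rpow_eq_tsum (p := 2) (by norm_num) (toL2 f)
  simpa [toL2] using this

/-- The Hardy norm `(sup_{0 ≤ r < 1} (1 / 2π) ∫ |f (r e ^ {iθ})| ^ 2 dθ) ^ (1 / 2)`. -/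
def hardyNorm (f : HardySpace) : ℝ := √(⨆ r : Set.Ico (0 : ℝ) 1, integralMean f r)

theorem bddAbove_means (f : HardySpace) :
    BddAbove (Set.range fun r : Set.Ico (0 : ℝ) 1 => integralMean f r) := by
  obtain ⟨C, hC⟩ := f.2.2
  exact ⟨C, by rintro _ ⟨r, rfl⟩; exact hC r r.2.1 r.2.2⟩

theorem iSup_means (f : HardySpace) :
    ⨆ r : Set.Ico (0 : ℝ) 1, integralMean f r = ∑' n, ‖discCoeff f n‖ ^ 2 := by
  have : Nonempty (Set.Ico (0 : ℝ) 1) := ⟨⟨0, by simp⟩⟩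
  refine le_antisymm (ciSup_le fun r => ?_) ?_
  · exact means_le_tsum f.analytic.hasSum f.summable_coeff r.2.1 r.2.2
  · refine f.summable_coeff.tsum_le_of_sum_le fun s => ?_
    exact summable_of_means_le f.analytic.hasSum
      (fun r h0 h1 => le_ciSup f.bddAbove_means ⟨r, h0, h1⟩) s

theorem hardyNorm_eq (f : HardySpace) : f.hardyNorm = ‖toL2 f‖ := by
  rw [hardyNorm, iSup_means, ← norm_toL2_sq, Real.sqrt_sq (norm_nonneg _)]

theorem toL2_injective : Function.Injective toL2 := by
  intro f g h
  have hc : discCoeff f = discCoeff g := congrArg Subtype.val h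
  refine ext_fun fun z => ?_
  have h1 := f.analytic.hasSum z z.norm_lt_one
  rw [hc] at h1
  have := h1.unique (g.analytic.hasSum z z.norm_lt_one)
  rwa [discExt_coe, discExt_coe] at this

instance : NormedAddCommGroup HardySpace := AddGroupNorm.toNormedAddCommGroup
  { toFun := hardyNorm
    map_zero' := by simp [hardyNorm_eq]
    add_le' := fun f g => by simpa [hardyNorm_eq] using norm_add_le (toL2 f) (toL2 g)
    neg' := fun f => by simp [hardyNorm_eq]
    eq_zero_of_map_eq_zero' := fun f hf => by
      rw [hardyNorm_eq, norm_eq_zero] at hf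
      exact toL2_injective (by simpa using hf) }

theorem norm_def (f : HardySpace) : ‖f‖ = √(⨆ r : Set.Ico (0 : ℝ) 1, integralMean f r) := rfl

theorem norm_toL2 (f : HardySpace) : ‖toL2 f‖ = ‖f‖ := (hardyNorm_eq f).symm

/-- The Hilbert space structure; by polarization the norm determines the inner product. -/
instance : InnerProductSpace ℂ HardySpace where
  norm_smul_le c f := by rw [← norm_toL2, ← norm_toL2, map_smul, norm_smul]
  inner f g := inner ℂ (toL2 f) (toL2 g)
  norm_sq_eq_re_inner f := by rw [← norm_toL2]; exact norm_sq_eq_re_inner (toL2 f)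
  conj_inner_symm f g := inner_conj_symm _ _
  add_left f g h := by rw [map_add, inner_add_left]
  smul_left f g c := by rw [map_smul, inner_smul_left]

theorem inner_def (f g : HardySpace) : inner ℂ f g = inner ℂ (toL2 f) (toL2 g) := rfl

theorem toL2_surjective : Function.Surjective toL2 := by
  intro a
  have ha : Summable fun n => ‖a n‖ ^ 2 := by
    simpa using (memℓp_gen_iff (p := 2) (by norm_num)).1 a.2
  have hb : ∀ n, ‖a n‖ ≤ ‖a‖ := lp.norm_apply_le_norm (by norm_num) a
  have hs : ∀ z : ℂ, ‖z‖ < 1 → Summable fun n => a n * z ^ n := fun z hz => by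
    refine Summable.of_norm_bounded
      ((summable_geometric_of_lt_one (norm_nonneg z) hz).mul_left ‖a‖) fun n => ?_
    rw [norm_mul, norm_pow]
    exact mul_le_mul_of_nonneg_right (hb n) (by positivity)
  set f : 𝔻 → ℂ := fun z => ∑' n, a n * (z : ℂ) ^ n with hf
  have hsum : ∀ z : ℂ, ‖z‖ < 1 → HasSum (fun n => a n * z ^ n) (discExt f z) := fun z hz => by
    have : discExt f z = ∑' n, a n * z ^ n := by simp [discExt, hz, hf]
    rw [this]
    exact (hs z hz).hasSum
  have hfa : DiscAnalytic f := differentiableOn_of_hasSum hsum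
  refine ⟨⟨f, hfa, _, fun r h0 h1 => means_le_tsum hsum ha h0 h1⟩, Subtype.ext ?_⟩
  exact coeff_unique hfa.hasSum hsum

/-- The identification of the Hardy space with `ℓ²` through Taylor coefficients. -/
def equivL2 : HardySpace ≃ₗᵢ[ℂ] lp (fun _ : ℕ => ℂ) 2 :=
  { LinearEquiv.ofBijective toL2 ⟨toL2_injective, toL2_surjective⟩ with norm_map' := norm_toL2 }

instance : CompleteSpace HardySpace :=
  (completeSpace_congr (e := equivL2.toEquiv) equivL2.isometry.isUniformEmbedding).2 inferInstance

end HardySpace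

/-- The algebra `H^∞` of bounded analytic functions on the unit disc. -/
def HardyInfty : Subalgebra ℂ (𝔻 → ℂ) where
  carrier := {φ | DiscAnalytic φ ∧ ∃ C : ℝ, ∀ z, ‖φ z‖ ≤ C}
  algebraMap_mem' c := ⟨discAnalytic_const c, ‖c‖, fun _ => le_rfl⟩
  add_mem' := by
    rintro φ ψ ⟨hφ, C, hC⟩ ⟨hψ, D, hD⟩
    exact ⟨hφ.add hψ, C + D, fun z => norm_add_le_of_le (hC z) (hD z)⟩
  mul_mem' := by
    rintro φ ψ ⟨hφ, C, hC⟩ ⟨hψ, D, hD⟩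
    exact ⟨hφ.mul hψ, C * D, fun z => norm_mul_le_of_le (hC z) (hD z)⟩

theorem integralMean_mul_le {φ f : 𝔻 → ℂ} (hφ : DiscAnalytic φ) (hf : DiscAnalytic f) {C : ℝ}
    (hC : ∀ z, ‖φ z‖ ≤ C) {r : ℝ} (hr0 : 0 ≤ r) (hr1 : r < 1) :
    integralMean (φ * f) r ≤ C ^ 2 * integralMean f r := by
  unfold integralMean
  have hsm : C ^ 2 * Real.circleAverage (fun z => ‖discExt f z‖ ^ 2) 0 r
      = Real.circleAverage (fun z => C ^ 2 • ‖discExt f z‖ ^ 2) 0 r := by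
    rw [← smul_eq_mul, ← Real.circleAverage_fun_smul]
  rw [hsm]
  refine Real.circleAverage_mono ((hφ.mul hf).circleIntegrable hr0 hr1)
    ((hf.circleIntegrable hr0 hr1).const_smul (a := C ^ 2)) fun z hz => ?_
  rw [discExt_mul, Pi.mul_apply, norm_mul, mul_pow, smul_eq_mul]
  have hz1 : ‖z‖ < 1 := by
    rw [mem_sphere_zero_iff_norm, abs_of_nonneg hr0] at hz
    rwa [hz]
  have : ‖discExt φ z‖ ≤ C := by simpa [discExt, hz1] using hC (Complex.UnitDisc.mk z hz1)
  gcongr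

/-- The multiplication operator `M_φ g = φ g` on the Hardy space, for `φ` in `H^∞`. -/
def mulOp (φ : HardyInfty) : HardySpace →L[ℂ] HardySpace :=
  LinearMap.mkContinuousOfExistsBound
    (σ := RingHom.id ℂ)
    { toFun := fun g => ⟨φ.1 * g.1, φ.2.1.mul g.2.1, by
        obtain ⟨C, hC⟩ := φ.2.2
        obtain ⟨D, hD⟩ := g.2.2
        exact ⟨C ^ 2 * D, fun r h0 h1 => (integralMean_mul_le φ.2.1 g.2.1 hC h0 h1).trans
          (mul_le_mul_of_nonneg_left (hD r h0 h1) (by positivity))⟩⟩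
      map_add' := fun f g => Subtype.ext (mul_add φ.1 f.1 g.1)
      map_smul' := fun c f => Subtype.ext (mul_smul_comm c φ.1 f.1) }
    (by
      obtain ⟨C, hC⟩ := φ.2.2
      have hC0 : 0 ≤ C := (norm_nonneg _).trans (hC 0)
      have : Nonempty (Set.Ico (0 : ℝ) 1) := ⟨⟨0, by simp⟩⟩
      refine ⟨C, fun g => Real.sqrt_le_iff.2 ⟨by positivity, ciSup_le fun r => ?_⟩⟩
      refine (integralMean_mul_le φ.2.1 g.2.1 hC r.2.1 r.2.2).trans ?_
      have h0 : ‖g‖ ^ 2 = ⨆ r : Set.Ico (0 : ℝ) 1, integralMean g r := by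
        rw [HardySpace.norm_def, Real.sq_sqrt]
        rw [HardySpace.iSup_means]
        exact tsum_nonneg fun n => by positivity
      rw [mul_pow, h0]
      exact mul_le_mul_of_nonneg_left (le_ciSup g.bddAbove_means r) (by positivity))

@[simp] theorem mulOp_apply (φ : HardyInfty) (g : HardySpace) (z : 𝔻) :
    mulOp φ g z = φ.1 z * g z := rfl

/-- The class `B_n(Ω)` of Cowen and Douglas, for a connected open set `Ω` and `n ≥ 1`. -/
structure IsCowenDouglas {H : Type*} [NormedAddCommGroup H] [InnerProductSpace ℂ H]
    (n : ℕ) (Ω : Set ℂ) (T : H →L[ℂ] H) : Prop where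
  one_le : 1 ≤ n
  isOpen : IsOpen Ω
  isConnected : IsConnected Ω
  subset_spectrum : Ω ⊆ spectrum ℂ T
  range_eq_top : ∀ ω ∈ Ω, (T - ω • (1 : H →L[ℂ] H)).range = ⊤
  closure_span_ker : (⨆ ω ∈ Ω, (T - ω • (1 : H →L[ℂ] H)).ker).topologicalClosure = ⊤
  rank_ker : ∀ ω ∈ Ω, Module.rank ℂ (T - ω • (1 : H →L[ℂ] H)).ker = n

/-- `φ` is a Cowen-Douglas function: for some `n`, the adjoint of `M_φ` belongs to the class
`B_n` of the complex conjugate of the image `φ(𝔻)`. -/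
def IsCowenDouglasFunction (φ : HardyInfty) : Prop :=
  ∃ n : ℕ, IsCowenDouglas n (Set.range fun z : 𝔻 => conj (φ.1 z))
    (ContinuousLinearMap.adjoint (mulOp φ))

section Chaos

variable {X : Type*} [NormedAddCommGroup X] [NormedSpace ℂ X]

/-- Li-Yorke chaos: some `x` has `limsup ‖T ^ n x‖ > 0` (possibly infinite) and
`liminf ‖T ^ n x‖ = 0`. -/
def LiYorkeChaotic (T : X →L[ℂ] X) : Prop :=
  ∃ x : X, 0 < Filter.limsup (fun n : ℕ => ‖(T ^ n) x‖ₑ) Filter.atTop ∧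
    Filter.liminf (fun n : ℕ => ‖(T ^ n) x‖ₑ) Filter.atTop = 0

open Classical in
/-- `F_x^n(τ) = (1 / n) #{0 ≤ i ≤ n : ‖T ^ i x‖ < τ}`. -/
def distribFun (T : X →L[ℂ] X) (x : X) (n : ℕ) (τ : ℝ) : ℝ :=
  (1 / (n : ℝ)) * ((Finset.range (n + 1)).filter fun i => ‖(T ^ i) x‖ < τ).card

/-- Distributional chaos (of type I): for some `x`, the lower distribution function vanishes at
some `τ > 0` and the upper one is equal to `1` at every `ε > 0`. -/
def DistributionallyChaotic (T : X →L[ℂ] X) : Prop :=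
  ∃ x : X, (∃ τ > 0, Filter.liminf (fun n => distribFun T x n τ) Filter.atTop = 0) ∧
    ∀ ε > 0, Filter.limsup (fun n => distribFun T x n ε) Filter.atTop = 1

/-- Strong mixing, in the sense of topological dynamics. -/
def StronglyMixing (T : X →L[ℂ] X) : Prop :=
  ∀ U V : Set X, IsOpen U → U.Nonempty → IsOpen V → V.Nonempty →
    ∃ N : ℕ, ∀ n ≥ N, (((T ^ n : X →L[ℂ] X) '' U) ∩ V).Nonempty

/-- Devaney chaos: topological transitivity, a dense set of periodic points, and sensitive
dependence on initial conditions. -/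
structure DevaneyChaotic (T : X →L[ℂ] X) : Prop where
  transitive : ∀ U V : Set X, IsOpen U → U.Nonempty → IsOpen V → V.Nonempty →
    ∃ n : ℕ, (((T ^ n : X →L[ℂ] X) '' U) ∩ V).Nonempty
  dense_periodic : Dense (Function.periodicPts T)
  sensitive : ∃ δ > 0, ∀ x : X, ∀ ε > 0, ∃ y : X, dist x y < ε ∧
    ∃ n : ℕ, δ < dist ((T ^ n) x) ((T ^ n) y)

end Chaos

end

/-! Each of the four properties of `M_φ^*` is equivalent to one condition: `|φ|` takes the value 1
somewhere on the disc. Since `|φ| |1/φ| = 1` pointwise, this condition is the same for `φ` and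
`1/φ`, and the inverse of `M_φ^*` is the adjoint of multiplication by `1/φ`. The Cowen-Douglas
hypothesis enters through the openness of the range, which makes `φ` nonconstant.

If `|φ|` never equals 1, connectedness of the disc gives `|φ| ≤ 1` everywhere or `|φ| ≥ 1`
everywhere. Then `M_φ^*` or its inverse is a contraction, all orbit norms are monotone, and neither
transitivity nor Li-Yorke chaos is possible.

If `|φ(z₀)| = 1`, use that the reproducing kernel at `z` is an eigenvector of `M_φ^*` with
eigenvalue the conjugate of `φ(z)` (`adjoint_mulOp_kernel`). By the open mapping theorem `φ` covers
a neighbourhood of `φ(z₀)`, and by the identity theorem the kernels with `|φ(z)| < 1`, those with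
`|φ(z)| > 1`, and those with `φ(z)` a root of unity each span a dense subspace
(`dense_of_kernel_mem`). The first two families give mixing, the third gives dense periodic points,
and an eigenvalue outside the closed unit disc gives sensitivity. Together with the first family,
such an eigenvalue also gives distributional chaos by a Baire category argument
(`distributionallyChaotic_of_dense_nullOrbits`), and distributional chaos implies Li-Yorke chaos. -/

noncomputable section

open Filter Topology

/-! ### Counting the times at which an orbit satisfies a condition -/

section Counting

open Classical in
/-- The number of `i ≤ n` satisfying `p`. -/
def countUpTo (p : ℕ → Prop) (n : ℕ) : ℕ := ((Finset.range (n + 1)).filter p).card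

theorem countUpTo_add_not (p : ℕ → Prop) (n : ℕ) :
    countUpTo p n + countUpTo (fun i => ¬ p i) n = n + 1 := by
  classical
  simp only [countUpTo, Finset.card_filter, ← Finset.sum_add_distrib]
  rw [Finset.sum_congr rfl (g := fun _ => 1) fun i _ => by by_cases h : p i <;> simp [h]]
  simp

theorem countUpTo_mono {p q : ℕ → Prop} (h : ∀ i, p i → q i) (n : ℕ) :
    countUpTo p n ≤ countUpTo q n := by
  classical
  unfold countUpTo
  exact Finset.card_le_card (Finset.monotone_filter_right _ fun i _ hi => h i hi)

theorem countUpTo_le {p : ℕ → Prop} {N : ℕ} (h : ∀ i, p i → i < N) (n : ℕ) :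
    countUpTo p n ≤ N := by
  classical
  unfold countUpTo
  refine (Finset.card_le_card (t := Finset.range N) fun i hi => ?_).trans_eq (Finset.card_range N)
  exact Finset.mem_range.2 (h i (Finset.mem_filter.1 hi).2)

/-- Only a bounded number `N` of indices fail, which is below `δ n` once `n > N / δ`. -/
theorem eventually_lt_countUpTo {p : ℕ → Prop} (hp : ∀ᶠ i in atTop, p i) {δ : ℝ} (hδ : 0 < δ) :
    ∀ᶠ n : ℕ in atTop, (1 - δ) * n < countUpTo p n := by
  obtain ⟨N, hN⟩ := eventually_atTop.1 hp
  obtain ⟨M, hM⟩ := exists_nat_gt (N / δ)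
  filter_upwards [eventually_ge_atTop M] with n hn
  have h1 : countUpTo (fun i => ¬ p i) n ≤ N :=
    countUpTo_le (fun i hi => by by_contra h; exact hi (hN i (not_lt.1 h))) n
  have h2 : (countUpTo p n : ℝ) + countUpTo (fun i => ¬ p i) n = n + 1 := by
    exact_mod_cast countUpTo_add_not p n
  have h3 : (countUpTo (fun i => ¬ p i) n : ℝ) ≤ N := by exact_mod_cast h1
  have h4 : (M : ℝ) ≤ n := by exact_mod_cast hn
  have h5 : (N : ℝ) < n * δ := (div_lt_iff₀ hδ).1 (hM.trans_le h4)
  linarith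

/-- The finitely many memberships counted at `x` persist near `x`, so the count is lower
semicontinuous. -/
theorem isOpen_lt_countUpTo {X : Type*} [TopologicalSpace X] {U : ℕ → Set X}
    (hU : ∀ i, IsOpen (U i)) (n : ℕ) (c : ℝ) :
    IsOpen {x | c < countUpTo (fun i => x ∈ U i) n} := by
  classical
  refine isOpen_iff_mem_nhds.2 fun x hx => ?_
  have h : ∀ᶠ y in 𝓝 x, ∀ i ∈ (Finset.range (n + 1)).filter fun i => x ∈ U i, y ∈ U i :=
    (eventually_all_finset _).2 fun i hi => (hU i).mem_nhds (Finset.mem_filter.1 hi).2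
  filter_upwards [h] with y hy
  refine lt_of_lt_of_le hx ?_
  unfold countUpTo
  norm_cast
  refine Finset.card_le_card fun i hi => ?_
  have h1 := hy i (by simpa using hi)
  simp only [Finset.mem_filter] at hi ⊢
  exact ⟨hi.1, h1⟩

theorem dense_exists_lt_countUpTo {X : Type*} [TopologicalSpace X] {U : ℕ → Set X}
    {D : Set X} (hD : Dense D)
    (h : ∀ x ∈ D, ∀ᶠ i in atTop, x ∈ U i) {δ : ℝ} (hδ : 0 < δ) (k : ℕ) :
    Dense {x | ∃ n ≥ k, (1 - δ) * n < countUpTo (fun i => x ∈ U i) n} :=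
  hD.mono fun x hx => ((eventually_ge_atTop k).and (eventually_lt_countUpTo (h x hx) hδ)).exists

theorem isOpen_exists_lt_countUpTo {X : Type*} [TopologicalSpace X] {U : ℕ → Set X}
    (hU : ∀ i, IsOpen (U i)) (δ : ℝ) (k : ℕ) :
    IsOpen {x | ∃ n ≥ k, (1 - δ) * n < countUpTo (fun i => x ∈ U i) n} := by
  have : {x | ∃ n ≥ k, (1 - δ) * n < countUpTo (fun i => x ∈ U i) n}
      = ⋃ n ≥ k, {x | (1 - δ) * n < countUpTo (fun i => x ∈ U i) n} := by ext; simp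
  rw [this]
  exact isOpen_biUnion fun n _ => isOpen_lt_countUpTo hU n _

end Counting

/-! ### Distribution functions and chaos criteria for operators -/

section Dynamics

variable {X : Type*} [NormedAddCommGroup X] [NormedSpace ℂ X]

theorem distribFun_eq (T : X →L[ℂ] X) (x : X) (n : ℕ) (τ : ℝ) :
    distribFun T x n τ = 1 / (n : ℝ) * countUpTo (fun i => ‖(T ^ i) x‖ < τ) n := rfl

theorem distribFun_nonneg (T : X →L[ℂ] X) (x : X) (n : ℕ) (τ : ℝ) : 0 ≤ distribFun T x n τ := by
  rw [distribFun_eq]; positivity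

/-- There are `n + 1` indices but the divisor is `n`, so the value may exceed 1, by at most `1 / n`.
At `n = 0` the convention `1 / 0 = 0` makes it vanish. Such bounds are needed because `liminf` and
`limsup` of reals are meaningful only for bounded sequences. -/
theorem distribFun_le (T : X →L[ℂ] X) (x : X) (n : ℕ) (τ : ℝ) :
    distribFun T x n τ ≤ 1 + 1 / (n : ℝ) := by
  rcases Nat.eq_zero_or_pos n with rfl | hn
  · simp [distribFun_eq]
  have h : (countUpTo (fun i => ‖(T ^ i) x‖ < τ) n : ℝ) ≤ n + 1 := by
    exact_mod_cast (Nat.le_add_right _ _).trans_eq (countUpTo_add_not _ n)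
  have hn' : (0 : ℝ) < n := by exact_mod_cast hn
  rw [distribFun_eq, one_div_mul_eq_div, div_le_iff₀ hn', add_mul, one_div_mul_cancel hn'.ne',
    one_mul]
  exact h

theorem distribFun_le_two (T : X →L[ℂ] X) (x : X) (n : ℕ) (τ : ℝ) : distribFun T x n τ ≤ 2 := by
  refine (distribFun_le T x n τ).trans ?_
  have : 1 / (n : ℝ) ≤ 1 := by
    rw [one_div]; exact Nat.cast_inv_le_one n
  linarith

theorem isBoundedUnder_le_distribFun (T : X →L[ℂ] X) (x : X) (τ : ℝ) :
    IsBoundedUnder (· ≤ ·) atTop fun n => distribFun T x n τ :=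
  isBoundedUnder_of ⟨2, fun n => distribFun_le_two T x n τ⟩

theorem isBoundedUnder_ge_distribFun (T : X →L[ℂ] X) (x : X) (τ : ℝ) :
    IsBoundedUnder (· ≥ ·) atTop fun n => distribFun T x n τ :=
  isBoundedUnder_of ⟨0, fun n => distribFun_nonneg T x n τ⟩

theorem lt_distribFun {T : X →L[ℂ] X} {x : X} {n : ℕ} {τ c : ℝ} (hn : 0 < n)
    (h : c * n < countUpTo (fun i => ‖(T ^ i) x‖ < τ) n) : c < distribFun T x n τ := by
  have hn' : (0 : ℝ) < n := by exact_mod_cast hn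
  rwa [distribFun_eq, one_div_mul_eq_div, lt_div_iff₀ hn']

theorem distribFun_lt {T : X →L[ℂ] X} {x : X} {n : ℕ} {τ c : ℝ} (hn : 0 < n)
    (h : (1 - c) * n < countUpTo (fun i => ¬ ‖(T ^ i) x‖ < τ) n) :
    distribFun T x n τ < c + 1 / n := by
  have hn' : (0 : ℝ) < n := by exact_mod_cast hn
  have h2 : (countUpTo (fun i => ‖(T ^ i) x‖ < τ) n : ℝ)
      + countUpTo (fun i => ¬ ‖(T ^ i) x‖ < τ) n = n + 1 := by
    exact_mod_cast countUpTo_add_not _ n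
  rw [distribFun_eq, one_div_mul_eq_div, div_lt_iff₀ hn', add_mul, one_div_mul_cancel hn'.ne']
  linarith

/-- Use the same vector. If its orbit tended to zero, the lower distribution function would be
positive at every threshold; if its orbit stayed away from zero, the upper one would be below 1 at
some threshold. -/
theorem DistributionallyChaotic.liYorkeChaotic {T : X →L[ℂ] X} (h : DistributionallyChaotic T) :
    LiYorkeChaotic T := by
  obtain ⟨x, ⟨τ, hτ, hinf⟩, hsup⟩ := h
  refine ⟨x, pos_iff_ne_zero.2 fun h0 => ?_, ?_⟩
  · have h1 : ∀ᶠ i in atTop, ‖(T ^ i) x‖ < τ := by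
      have := eventually_lt_of_limsup_lt (f := atTop) (u := fun n : ℕ => ‖(T ^ n) x‖ₑ)
        (b := ENNReal.ofReal τ) (by rw [h0]; simpa using hτ)
      filter_upwards [this] with i hi
      rwa [← ofReal_norm, ENNReal.ofReal_lt_ofReal_iff hτ] at hi
    have h2 : ∀ᶠ n : ℕ in atTop, (1 / 2 : ℝ) ≤ distribFun T x n τ := by
      filter_upwards [eventually_lt_countUpTo h1 (δ := 1 / 2) (by norm_num),
        eventually_gt_atTop 0] with n hn hn0
      exact (lt_distribFun hn0 (by norm_num at hn ⊢; exact hn)).le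
    have := le_liminf_of_le (isBoundedUnder_le_distribFun T x τ).isCoboundedUnder_ge h2
    rw [hinf] at this
    norm_num at this
  · by_contra h0
    obtain ⟨ε, hε, hε'⟩ := exists_between (pos_iff_ne_zero.2 h0)
    have hεtop : ε ≠ ⊤ := hε'.ne_top
    have hε0 : 0 < ε.toReal := ENNReal.toReal_pos hε.ne' hεtop
    have h1 : ∀ᶠ i in atTop, ¬ ‖(T ^ i) x‖ < ε.toReal := by
      filter_upwards [eventually_lt_of_lt_liminf hε'] with i hi hlt
      rw [← ofReal_norm, ← ENNReal.ofReal_toReal hεtop] at hi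
      exact hlt.not_ge ((ENNReal.ofReal_lt_ofReal_iff_of_nonneg hε0.le).1 hi).le
    -- The bound is `1 / 4 + 1 / n` with `n ≥ 2`.
    have h2 : ∀ᶠ n : ℕ in atTop, distribFun T x n ε.toReal ≤ 3 / 4 := by
      filter_upwards [eventually_lt_countUpTo h1 (δ := 1 / 4) (by norm_num),
        eventually_ge_atTop 2] with n hn hn0
      refine (distribFun_lt (by omega) hn).le.trans ?_
      have : (1 : ℝ) / n ≤ 1 / 2 := one_div_le_one_div_of_le (by norm_num) (by exact_mod_cast hn0)
      linarith
    have := limsup_le_of_le (isBoundedUnder_ge_distribFun T x _).isCoboundedUnder_le h2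
    rw [hsup _ hε0] at this
    norm_num at this

theorem distributionallyChaotic_of_frequently {T : X →L[ℂ] X} {x : X}
    (h1 : ∀ k : ℕ, ∃ n ≥ k + 1, (1 - 1 / ((k : ℝ) + 1)) * n <
      countUpTo (fun i => ‖(T ^ i) x‖ < 1 / ((k : ℝ) + 1)) n)
    (h2 : ∀ k : ℕ, ∃ n ≥ k + 1, (1 - 1 / ((k : ℝ) + 1)) * n <
      countUpTo (fun i => 1 < ‖(T ^ i) x‖) n) : DistributionallyChaotic T := by
  refine ⟨x, ⟨1, one_pos, le_antisymm ?_ ?_⟩, fun ε hε => le_antisymm ?_ ?_⟩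
  · refine le_of_forall_pos_le_add fun δ hδ => ?_
    rw [zero_add]
    refine liminf_le_of_frequently_le (frequently_atTop.2 fun N => ?_)
      (isBoundedUnder_ge_distribFun T x 1)
    -- Half of `δ` pays for the exceptional indices, the other half for the excess `1 / n`.
    obtain ⟨m, hm⟩ := exists_nat_one_div_lt (half_pos hδ)
    obtain ⟨n, hn, hc⟩ := h2 (max m N)
    refine ⟨n, (le_max_right m N).trans (by omega), ?_⟩
    have hmk : 1 / (((max m N : ℕ) : ℝ) + 1) ≤ 1 / ((m : ℝ) + 1) := by
      refine one_div_le_one_div_of_le (by positivity) ?_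
      have : (m : ℝ) ≤ (max m N : ℕ) := by exact_mod_cast le_max_left m N
      linarith
    have hnk : 1 / (n : ℝ) ≤ 1 / (((max m N : ℕ) : ℝ) + 1) :=
      one_div_le_one_div_of_le (by positivity) (by exact_mod_cast hn)
    refine (distribFun_lt (by omega) (hc.trans_le ?_)).le.trans
      (by linarith : 1 / (((max m N : ℕ) : ℝ) + 1) + 1 / (n : ℝ) ≤ δ)
    exact_mod_cast countUpTo_mono (fun i (hi : 1 < ‖(T ^ i) x‖) => hi.le.not_gt) n
  · exact le_liminf_of_le (isBoundedUnder_le_distribFun T x 1).isCoboundedUnder_ge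
      (Eventually.of_forall fun n => distribFun_nonneg T x n 1)
  · have ht : Tendsto (fun n : ℕ => 1 + 1 / (n : ℝ)) atTop (𝓝 1) := by
      simpa using tendsto_const_nhds.add (tendsto_one_div_atTop_nhds_zero_nat (𝕜 := ℝ))
    rw [← ht.limsup_eq]
    exact limsup_le_limsup (Eventually.of_forall fun n => distribFun_le T x n ε)
      (isBoundedUnder_ge_distribFun T x _).isCoboundedUnder_le ht.isBoundedUnder_le
  · refine le_of_forall_pos_le_add fun δ hδ => ?_
    rw [← sub_le_iff_le_add]
    refine le_limsup_of_frequently_le (frequently_atTop.2 fun N => ?_)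
      (isBoundedUnder_le_distribFun T x ε)
    -- In `h1` the number `1 / (k + 1)` is both the allowed deficit and the threshold, so it must be
    -- below both `δ` and `ε`.
    obtain ⟨m, hm⟩ := exists_nat_one_div_lt (lt_min hδ hε)
    obtain ⟨n, hn, hc⟩ := h1 (max m N)
    refine ⟨n, (le_max_right m N).trans (by omega), ?_⟩
    have hmk : 1 / (((max m N : ℕ) : ℝ) + 1) ≤ 1 / ((m : ℝ) + 1) := by
      refine one_div_le_one_div_of_le (by positivity) ?_
      have : (m : ℝ) ≤ (max m N : ℕ) := by exact_mod_cast le_max_left m N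
      linarith
    have hδ' := hm.trans_le (min_le_left _ _)
    have hε' := hm.trans_le (min_le_right _ _)
    refine (by linarith : 1 - δ ≤ 1 - 1 / (((max m N : ℕ) : ℝ) + 1)).trans
      (lt_distribFun (by omega) (hc.trans_le ?_)).le
    exact_mod_cast countUpTo_mono
      (fun i (hi : ‖(T ^ i) x‖ < _) => hi.trans_le (hmk.trans hε'.le)) n

/-! ### Eigenvectors, null orbits and periodic points -/

theorem pow_apply_eigenvector {T : X →L[ℂ] X} {v : X} {μ : ℂ} (h : T v = μ • v) (n : ℕ) :
    (T ^ n) v = μ ^ n • v := by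
  induction n with
  | zero => simp
  | succ n ih => rw [pow_succ, mul_apply_eq_comp, h, map_smul, ih, smul_smul, pow_succ']

theorem tendsto_norm_pow_apply_eigenvector {T : X →L[ℂ] X} {v : X} {μ : ℂ} (h : T v = μ • v)
    (hμ : 1 < ‖μ‖) (hv : v ≠ 0) : Tendsto (fun n : ℕ => ‖(T ^ n) v‖) atTop atTop := by
  simp_rw [pow_apply_eigenvector h, norm_smul, norm_pow]
  exact (tendsto_pow_atTop_atTop_of_one_lt hμ).atTop_mul_const (norm_pos_iff.2 hv)

/-- The vectors whose orbit converges to zero. -/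
def nullOrbits (T : X →L[ℂ] X) : Submodule ℂ X where
  carrier := {x | Tendsto (fun n : ℕ => (T ^ n) x) atTop (𝓝 0)}
  zero_mem' := by simp
  add_mem' := fun {x y} hx hy => by
    simpa only [Set.mem_ofPred_eq, map_add, add_zero] using Tendsto.add hx hy
  smul_mem' := fun c x hx => by
    simpa only [Set.mem_ofPred_eq, map_smul, smul_zero] using Tendsto.const_smul hx c

theorem mem_nullOrbits {T : X →L[ℂ] X} {x : X} :
    x ∈ nullOrbits T ↔ Tendsto (fun n : ℕ => (T ^ n) x) atTop (𝓝 0) := Iff.rfl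

theorem eigenvector_mem_nullOrbits {T : X →L[ℂ] X} {v : X} {μ : ℂ} (h : T v = μ • v)
    (hμ : ‖μ‖ < 1) : v ∈ nullOrbits T := by
  rw [mem_nullOrbits]
  simp_rw [pow_apply_eigenvector h]
  simpa using (tendsto_pow_atTop_nhds_zero_of_norm_lt_one hμ).smul_const v

/-- The periodic points of a linear operator form a subspace. -/
def periodicSubmodule (T : X →L[ℂ] X) : Submodule ℂ X where
  carrier := {x | ∃ n > 0, (T ^ n) x = x}
  zero_mem' := ⟨1, one_pos, map_zero _⟩
  add_mem' := by
    rintro x y ⟨m, hm, hx⟩ ⟨n, hn, hy⟩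
    have key : ∀ {k : ℕ} {z : X} (l : ℕ), (T ^ k) z = z → (T ^ (k * l)) z = z := by
      intro k z l hz
      -- A point fixed by `T ^ k` is an eigenvector of `T ^ k` with eigenvalue 1.
      have := pow_apply_eigenvector (T := T ^ k) (v := z) (μ := 1) (by simpa using hz) l
      simpa [pow_mul] using this
    refine ⟨m * n, Nat.mul_pos hm hn, ?_⟩
    rw [map_add, key n hx, mul_comm m n, key m hy]
  smul_mem' := by
    rintro c x ⟨n, hn, hx⟩
    exact ⟨n, hn, by rw [map_smul, hx]⟩

theorem periodicSubmodule_subset (T : X →L[ℂ] X) :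
    (periodicSubmodule T : Set X) ⊆ Function.periodicPts T := by
  rintro x ⟨n, hn, hx⟩
  refine ⟨n, hn, ?_⟩
  rw [Function.IsPeriodicPt, Function.IsFixedPt, ← FunLike.coe_pow_eq_iterate]
  exact hx

theorem eigenvector_mem_periodicSubmodule {T : X →L[ℂ] X} {v : X} {μ : ℂ} (h : T v = μ • v)
    {n : ℕ} (hn : 0 < n) (hμ : μ ^ n = 1) : v ∈ periodicSubmodule T :=
  ⟨n, hn, by rw [pow_apply_eigenvector h, hμ, one_smul]⟩

/-- Baire category. For each `k`, having small norm at most times up to some large `n` is an open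
condition, dense because null orbits satisfy it. Having norm above 1 at most times up to some large
`n` is likewise open, and dense because adding a small multiple of `v` to a null-orbit vector makes
its orbit diverge. A vector in the intersection over all `k` is distributionally irregular. -/
theorem distributionallyChaotic_of_dense_nullOrbits [CompleteSpace X] {T : X →L[ℂ] X}
    (hT : Dense (nullOrbits T : Set X)) {v : X} (hv : v ≠ 0) {μ : ℂ} (hTv : T v = μ • v)
    (hμ : 1 < ‖μ‖) : DistributionallyChaotic T := by
  set A : ℕ → ℕ → Set X := fun k i => {x | ‖(T ^ i) x‖ < 1 / ((k : ℝ) + 1)}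
  set B : ℕ → Set X := fun i => {x | 1 < ‖(T ^ i) x‖}
  have hA : ∀ k i, IsOpen (A k i) := fun k i => isOpen_lt (by fun_prop) continuous_const
  have hB : ∀ i, IsOpen (B i) := fun i => isOpen_lt continuous_const (by fun_prop)
  have hδ : ∀ k : ℕ, 0 < 1 / ((k : ℝ) + 1) := fun k => by positivity
  have hAe : ∀ k, ∀ x ∈ (nullOrbits T : Set X), ∀ᶠ i in atTop, x ∈ A k i := fun k x hx => by
    have := (mem_nullOrbits.1 hx).norm
    rw [norm_zero] at this
    exact this.eventually_lt_const (hδ k)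
  have hBD : Dense {x : X | Tendsto (fun n : ℕ => ‖(T ^ n) x‖) atTop atTop} := by
    refine Metric.dense_iff.2 fun x r hr => ?_
    obtain ⟨y, hy, hyT⟩ := Metric.dense_iff.1 hT x (r / 2) (half_pos hr)
    -- Scaled so that `c • v` has norm `r / 2`.
    set c : ℝ := r / 2 / ‖v‖
    have hv' : 0 < ‖v‖ := norm_pos_iff.2 hv
    have hc : 0 < c := by positivity
    refine ⟨y + (c : ℂ) • v, ?_, ?_⟩
    · rw [Metric.mem_ball, dist_eq_norm] at hy ⊢
      calc ‖y + (c : ℂ) • v - x‖ = ‖(y - x) + (c : ℂ) • v‖ := by congr 1; abel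
        _ ≤ ‖y - x‖ + ‖(c : ℂ) • v‖ := norm_add_le _ _
        _ = ‖y - x‖ + r / 2 := by
            rw [norm_smul, Complex.norm_real, Real.norm_of_nonneg hc.le, div_mul_cancel₀ _ hv'.ne']
        _ < r := by linarith
    · have h1 : Tendsto (fun n : ℕ => ‖(T ^ n) ((c : ℂ) • v)‖) atTop atTop := by
        refine tendsto_norm_pow_apply_eigenvector (μ := μ) ?_ hμ ?_
        · rw [map_smul, hTv, smul_comm]
        · exact smul_ne_zero (by exact_mod_cast hc.ne') hv
      have h2 := (mem_nullOrbits.1 hyT).norm.neg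
      refine tendsto_atTop_mono (fun n => ?_) (h1.atTop_add h2)
      rw [map_add, add_comm ((T ^ n) y), ← sub_eq_add_neg]
      exact norm_sub_le_norm_add _ _
  have hBe : ∀ x ∈ {x : X | Tendsto (fun n : ℕ => ‖(T ^ n) x‖) atTop atTop},
      ∀ᶠ i in atTop, x ∈ B i := fun x hx => hx.eventually_gt_atTop 1
  have hdense := dense_iInter_of_isOpen_nat
    (fun k => (isOpen_exists_lt_countUpTo (hA k) (1 / ((k : ℝ) + 1)) (k + 1)).inter
      (isOpen_exists_lt_countUpTo hB (1 / ((k : ℝ) + 1)) (k + 1)))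
    (fun k => (dense_exists_lt_countUpTo hT (hAe k) (hδ k) (k + 1)).inter_of_isOpen_left
      (dense_exists_lt_countUpTo hBD hBe (hδ k) (k + 1))
      (isOpen_exists_lt_countUpTo (hA k) (1 / ((k : ℝ) + 1)) (k + 1)))
  obtain ⟨x, hx⟩ := hdense.nonempty
  rw [Set.mem_iInter] at hx
  exact distributionallyChaotic_of_frequently (x := x) (fun k => (hx k).1) fun k => (hx k).2

/-- Kitai's argument: with `x ∈ U` and `y ∈ V` having null orbits under `T` and `S = T⁻¹`
respectively, the points `x + S ^ n y` tend to `x` while their images under `T ^ n`, namely `T ^ n x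
+ y`, tend to `y`. -/
theorem stronglyMixing_of_dense_nullOrbits {T S : X →L[ℂ] X} (hTS : T * S = 1) (hST : S * T = 1)
    (hT : Dense (nullOrbits T : Set X)) (hS : Dense (nullOrbits S : Set X)) :
    StronglyMixing T := by
  intro U V hU hUne hV hVne
  obtain ⟨x, hxU, hx⟩ := hT.inter_open_nonempty U hU hUne
  obtain ⟨y, hyV, hy⟩ := hS.inter_open_nonempty V hV hVne
  have h1 : Tendsto (fun n : ℕ => x + (S ^ n) y) atTop (𝓝 x) := by
    simpa using (mem_nullOrbits.1 hy).const_add x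
  have h2 : Tendsto (fun n : ℕ => (T ^ n) (x + (S ^ n) y)) atTop (𝓝 y) := by
    have : ∀ n : ℕ, (T ^ n) (x + (S ^ n) y) = (T ^ n) x + y := fun n => by
      have hc : Commute T S := hTS.trans hST.symm
      rw [map_add, ← mul_apply_eq_comp, ← hc.mul_pow, hTS, one_pow,
        one_apply_eq_self]
    simp_rw [this]
    simpa using (mem_nullOrbits.1 hx).add_const y
  obtain ⟨N, hN⟩ := eventually_atTop.1
    ((h1.eventually (hU.mem_nhds hxU)).and (h2.eventually (hV.mem_nhds hyV)))
  exact ⟨N, fun n hn => ⟨_, ⟨_, (hN n hn).1, rfl⟩, (hN n hn).2⟩⟩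

/-- By linearity the orbits of `x` and `x + c • v` differ by the orbit of `c • v`, which is
unbounded however small `c > 0` is; hence any `δ` works. -/
theorem sensitive_of_eigenvector {T : X →L[ℂ] X} {v : X} (hv : v ≠ 0) {μ : ℂ}
    (hTv : T v = μ • v) (hμ : 1 < ‖μ‖) :
    ∃ δ > 0, ∀ x : X, ∀ ε > 0, ∃ y : X, dist x y < ε ∧
      ∃ n : ℕ, δ < dist ((T ^ n) x) ((T ^ n) y) := by
  refine ⟨1, one_pos, fun x ε hε => ?_⟩
  have hv' : 0 < ‖v‖ := norm_pos_iff.2 hv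
  set c : ℝ := ε / 2 / ‖v‖
  have hc : 0 < c := by positivity
  refine ⟨x + (c : ℂ) • v, ?_, ?_⟩
  · rw [dist_self_add_right, norm_smul, Complex.norm_real, Real.norm_of_nonneg hc.le,
      div_mul_cancel₀ _ hv'.ne']
    exact half_lt_self hε
  · have h1 : Tendsto (fun n : ℕ => ‖(T ^ n) ((c : ℂ) • v)‖) atTop atTop := by
      refine tendsto_norm_pow_apply_eigenvector (μ := μ) ?_ hμ ?_
      · rw [map_smul, hTv, smul_comm]
      · exact smul_ne_zero (by exact_mod_cast hc.ne') hv
    obtain ⟨n, hn⟩ := (h1.eventually_gt_atTop 1).exists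
    exact ⟨n, by rwa [map_add, dist_self_add_right]⟩

/-- Topological transitivity. -/
def TopTransitive (T : X →L[ℂ] X) : Prop :=
  ∀ U V : Set X, IsOpen U → U.Nonempty → IsOpen V → V.Nonempty →
    ∃ n : ℕ, (((T ^ n : X →L[ℂ] X) '' U) ∩ V).Nonempty

theorem StronglyMixing.topTransitive {T : X →L[ℂ] X} (h : StronglyMixing T) : TopTransitive T :=
  fun U V hU hU' hV hV' => let ⟨N, hN⟩ := h U V hU hU' hV hV'; ⟨N, hN N le_rfl⟩

/-! ### Contractions and expansions are not chaotic -/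

theorem norm_pow_apply_antitone {T : X →L[ℂ] X} (hT : ∀ x, ‖T x‖ ≤ ‖x‖) (x : X) :
    Antitone fun n : ℕ => ‖(T ^ n) x‖ :=
  antitone_nat_of_succ_le fun n => by
    rw [pow_succ', mul_apply_eq_comp]; exact hT _

theorem norm_pow_apply_monotone {T : X →L[ℂ] X} (hT : ∀ x, ‖x‖ ≤ ‖T x‖) (x : X) :
    Monotone fun n : ℕ => ‖(T ^ n) x‖ :=
  monotone_nat_of_le_succ fun n => by
    rw [pow_succ', mul_apply_eq_comp]; exact hT _

/-- No orbit starting in the open unit ball ever leaves it. -/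
theorem not_topTransitive_of_norm_le [Nontrivial X] {T : X →L[ℂ] X} (hT : ∀ x, ‖T x‖ ≤ ‖x‖) :
    ¬ TopTransitive T := by
  intro h
  obtain ⟨v, hv⟩ := NormedSpace.exists_lt_norm ℂ X 1
  obtain ⟨n, _, ⟨x, hx, rfl⟩, hy⟩ := h {x | ‖x‖ < 1} {x | 1 < ‖x‖}
    (isOpen_lt continuous_norm continuous_const) ⟨0, by simp⟩
    (isOpen_lt continuous_const continuous_norm) ⟨v, hv⟩
  have := norm_pow_apply_antitone hT x (Nat.zero_le n)
  simp only [pow_zero, one_apply_eq_self, Set.mem_ofPred_eq] at this hx hy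
  linarith

theorem not_topTransitive_of_le_norm [Nontrivial X] {T : X →L[ℂ] X} (hT : ∀ x, ‖x‖ ≤ ‖T x‖) :
    ¬ TopTransitive T := by
  intro h
  obtain ⟨v, hv⟩ := NormedSpace.exists_lt_norm ℂ X 1
  obtain ⟨n, _, ⟨x, hx, rfl⟩, hy⟩ := h {x | 1 < ‖x‖} {x | ‖x‖ < 1}
    (isOpen_lt continuous_const continuous_norm) ⟨v, hv⟩
    (isOpen_lt continuous_norm continuous_const) ⟨0, by simp⟩
  have := norm_pow_apply_monotone hT x (Nat.zero_le n)
  simp only [pow_zero, one_apply_eq_self, Set.mem_ofPred_eq] at this hx hy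
  linarith

/-- Monotone orbit norms converge in `[0, ∞]`, so their `limsup` and `liminf` coincide. -/
theorem not_liYorkeChaotic_of_norm_le {T : X →L[ℂ] X} (hT : ∀ x, ‖T x‖ ≤ ‖x‖) :
    ¬ LiYorkeChaotic T := by
  rintro ⟨x, hsup, hinf⟩
  have hmono : Antitone fun n : ℕ => ‖(T ^ n) x‖ₑ := fun m n hmn => by
    simpa only [← ofReal_norm] using ENNReal.ofReal_le_ofReal (norm_pow_apply_antitone hT x hmn)
  have ht := tendsto_atTop_iInf hmono
  rw [ht.limsup_eq] at hsup
  rw [ht.liminf_eq] at hinf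
  exact hsup.ne' hinf

theorem not_liYorkeChaotic_of_le_norm {T : X →L[ℂ] X} (hT : ∀ x, ‖x‖ ≤ ‖T x‖) :
    ¬ LiYorkeChaotic T := by
  rintro ⟨x, hsup, hinf⟩
  have hmono : Monotone fun n : ℕ => ‖(T ^ n) x‖ₑ := fun m n hmn => by
    simpa only [← ofReal_norm] using ENNReal.ofReal_le_ofReal (norm_pow_apply_monotone hT x hmn)
  have ht := tendsto_atTop_iSup hmono
  rw [ht.limsup_eq] at hsup
  rw [ht.liminf_eq] at hinf
  exact hsup.ne' hinf

end Dynamics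

/-! ### Reproducing kernels and their spans -/

namespace HardySpace

/-- These are the Taylor coefficients of the kernel at `z`. They are conjugated because the inner
product is conjugate-linear in its first argument, so that pairing with `f` returns its power series
at `z`. -/
theorem memℓp_geometric (z : 𝔻) : Memℓp (fun n : ℕ => conj (z : ℂ) ^ n) 2 := by
  refine memℓp_gen ?_
  have h : ‖(z : ℂ)‖ ^ 2 < 1 := z.sq_norm_lt_one
  refine (summable_geometric_of_lt_one (by positivity) h).congr fun n => ?_
  simp [← pow_mul, mul_comm]

/-- The reproducing kernel of the Hardy space at a point of the disc. -/
def kernel (z : 𝔻) : HardySpace := equivL2.symm ⟨_, memℓp_geometric z⟩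

theorem toL2_kernel (z : 𝔻) : toL2 (kernel z) = ⟨_, memℓp_geometric z⟩ :=
  equivL2.apply_symm_apply _

theorem inner_kernel (z : 𝔻) (f : HardySpace) : inner ℂ (kernel z) f = f z := by
  rw [inner_def, toL2_kernel]
  refine (lp.hasSum_inner _ _).unique ?_
  have h := f.analytic.hasSum z z.norm_lt_one
  rw [discExt_coe] at h
  refine hasSum_of_eq h fun n => ?_
  simp [toL2]

theorem kernel_ne_zero (z : 𝔻) : kernel z ≠ 0 := by
  intro h
  have h1 : (toL2 (kernel z) : ℕ → ℂ) 0 = 1 := by rw [toL2_kernel]; simp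
  rw [h, map_zero] at h1
  simp at h1

instance : Nontrivial HardySpace := ⟨⟨kernel 0, 0, kernel_ne_zero 0⟩⟩

/-- Kernels at points whose image lies in a set accumulating at a value of a nonconstant analytic
function span a dense subspace. -/
theorem dense_of_kernel_mem {φ : 𝔻 → ℂ} (hφ : DiscAnalytic φ) (hc : ¬ ∃ c, ∀ z, φ z = c)
    {S : Set ℂ} {z₀ : 𝔻} (hS : ∃ᶠ w in 𝓝[≠] (φ z₀), w ∈ S) {K : Submodule ℂ HardySpace}
    (hK : ∀ z, φ z ∈ S → kernel z ∈ K) : Dense (K : Set HardySpace) := by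
  have hball : IsPreconnected (Metric.ball (0 : ℂ) 1) := (convex_ball 0 1).isPreconnected
  have hz₀ : (z₀ : ℂ) ∈ Metric.ball (0 : ℂ) 1 := by simpa using z₀.norm_lt_one
  have hφa : AnalyticOnNhd ℂ (discExt φ) (Metric.ball 0 1) :=
    DifferentiableOn.analyticOnNhd hφ Metric.isOpen_ball
  have hmap : 𝓝 (φ z₀) ≤ map (discExt φ) (𝓝 z₀) := by
    rw [← discExt_coe φ z₀]
    -- Open mapping: otherwise `φ` is constant near `z₀`, hence on the disc by the identity theorem.
    refine (hφa _ hz₀).eventually_constant_or_nhds_le_map_nhds.resolve_left fun h => hc ?_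
    have := hφa.eqOn_of_preconnected_of_eventuallyEq analyticOnNhd_const hball hz₀ h
    refine ⟨discExt φ z₀, fun z => ?_⟩
    rw [← discExt_coe φ z]
    exact this (by simpa using z.norm_lt_one)
  -- Density is triviality of the orthogonal complement, and `f` orthogonal to the kernel at `z`
  -- means `f z = 0`.
  rw [Submodule.dense_iff_topologicalClosure_eq_top, Submodule.topologicalClosure_eq_top_iff,
    Submodule.eq_bot_iff]
  intro f hf
  have hzero : ∀ z, φ z ∈ S → f z = 0 := fun z hz => by
    rw [← inner_kernel]
    exact (Submodule.mem_orthogonal _ _).1 hf _ (hK z hz)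
  have hfa : AnalyticOnNhd ℂ (discExt f) (Metric.ball 0 1) :=
    DifferentiableOn.analyticOnNhd f.analytic Metric.isOpen_ball
  -- Values in `S` accumulating at `φ z₀` pull back to zeros of `f` accumulating at `z₀`. They
  -- differ from `z₀` because their images differ from `φ z₀`.
  have hfreq : ∃ᶠ z in 𝓝[≠] (z₀ : ℂ), discExt f z = 0 := by
    rw [frequently_nhdsWithin_iff] at hS ⊢
    have h1 : ∃ᶠ z in 𝓝 (z₀ : ℂ), discExt φ z ∈ S ∧ discExt φ z ∈ ({φ z₀}ᶜ : Set ℂ) :=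
      frequently_map.1 (hS.filter_mono hmap)
    refine (h1.and_eventually (Metric.isOpen_ball.mem_nhds hz₀)).mono ?_
    rintro z ⟨⟨hzS, hzne⟩, hz⟩
    lift z to 𝔻 using (by simpa using hz)
    rw [discExt_coe] at hzS hzne ⊢
    exact ⟨hzero z hzS, fun h => hzne (congrArg φ (Complex.UnitDisc.coe_injective h))⟩
  have h0 := hfa.eqOn_zero_of_preconnected_of_frequently_eq_zero hball hz₀ hfreq
  refine ext_fun fun z => ?_
  have := h0 (show (z : ℂ) ∈ Metric.ball (0 : ℂ) 1 by simpa using z.norm_lt_one)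
  rwa [discExt_coe] at this

end HardySpace

/-! ### Adjoints of multiplication operators -/

open HardySpace ContinuousLinearMap

/-- Pairing the left side with `f` evaluates `φ f` at `z`, which is `φ(z)` times the pairing of the
kernel with `f`. -/
theorem adjoint_mulOp_kernel (φ : HardyInfty) (z : 𝔻) :
    adjoint (mulOp φ) (kernel z) = conj (φ.1 z) • kernel z := by
  refine ext_inner_right ℂ fun f => ?_
  rw [adjoint_inner_left, inner_kernel, mulOp_apply, inner_smul_left, inner_kernel,
    Complex.conj_conj]

theorem adjoint_mulOp_mul (φ ψ : HardyInfty) :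
    adjoint (mulOp (φ * ψ)) = adjoint (mulOp φ) * adjoint (mulOp ψ) := by
  -- Multiplications commute; this order is chosen because the adjoint reverses it.
  have : mulOp (φ * ψ) = mulOp ψ ∘L mulOp φ := by
    ext f
    refine HardySpace.ext_fun fun z => ?_
    simp only [mulOp_apply, ContinuousLinearMap.comp_apply]
    change φ.1 z * ψ.1 z * f z = _
    ring
  rw [this, adjoint_comp]
  rfl

theorem adjoint_mulOp_one : adjoint (mulOp 1) = 1 := by
  have : mulOp 1 = ContinuousLinearMap.id ℂ HardySpace := by
    ext f
    refine HardySpace.ext_fun fun z => ?_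
    rw [mulOp_apply]
    exact one_mul _
  rw [this, adjoint_id]
  rfl

theorem norm_mulOp_apply_le {φ : HardyInfty} (hφ : ∀ z, ‖φ.1 z‖ ≤ 1) (g : HardySpace) :
    ‖mulOp φ g‖ ≤ ‖g‖ := by
  have : Nonempty (Set.Ico (0 : ℝ) 1) := ⟨⟨0, by simp⟩⟩
  rw [norm_def, norm_def]
  refine Real.sqrt_le_sqrt (ciSup_mono g.bddAbove_means fun r => ?_)
  exact (integralMean_mul_le φ.2.1 g.2.1 hφ r.2.1 r.2.2).trans_eq (by rw [one_pow, one_mul]; rfl)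

theorem norm_adjoint_mulOp_apply_le {φ : HardyInfty} (hφ : ∀ z, ‖φ.1 z‖ ≤ 1) (g : HardySpace) :
    ‖adjoint (mulOp φ) g‖ ≤ ‖g‖ := by
  have h1 : ‖mulOp φ‖ ≤ 1 :=
    opNorm_le_bound _ zero_le_one fun g => by simpa using norm_mulOp_apply_le hφ g
  rw [← LinearIsometryEquiv.norm_map adjoint] at h1
  simpa using le_of_opNorm_le _ h1 g

/-- Intermediate value theorem for `|φ|` on the connected disc. -/
theorem forall_norm_le_one_or_one_le {φ : 𝔻 → ℂ} (hφ : DiscAnalytic φ) (h : ∀ z, ‖φ z‖ ≠ 1) :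
    (∀ z, ‖φ z‖ ≤ 1) ∨ ∀ z, 1 ≤ ‖φ z‖ := by
  by_contra! hcon
  obtain ⟨⟨a, ha⟩, b, hb⟩ := hcon
  have hball : IsPreconnected (Metric.ball (0 : ℂ) 1) := (convex_ball 0 1).isPreconnected
  have hmem : ∀ z : 𝔻, (z : ℂ) ∈ Metric.ball (0 : ℂ) 1 := fun z => by simpa using z.norm_lt_one
  obtain ⟨z, hz, hz1⟩ := hball.intermediate_value (hmem b) (hmem a)
    (DifferentiableOn.continuousOn hφ).norm (show (1 : ℝ) ∈ Set.Icc _ _ by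
      rw [discExt_coe, discExt_coe]; exact ⟨hb.le, ha.le⟩)
  lift z to 𝔻 using (by simpa using hz)
  exact h z (by simpa only [discExt_coe] using hz1)

/-- A unimodular `w` lies in the closure of the open disc but not in the disc, so puncturing the
neighbourhood at `w` costs nothing. -/
theorem frequently_norm_lt_one {w : ℂ} (hw : ‖w‖ = 1) : ∃ᶠ u in 𝓝[≠] w, u ∈ {u : ℂ | ‖u‖ < 1} := by
  have h : w ∈ closure (Metric.ball (0 : ℂ) 1) := by
    rw [closure_ball _ one_ne_zero]; simp [hw]
  rw [← mem_closure_ne_iff_frequently_within]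
  refine closure_mono (fun u hu => ?_) h
  rw [mem_ball_zero_iff] at hu
  exact ⟨hu, fun h => by rw [Set.mem_singleton_iff] at h; rw [h, hw] at hu; exact lt_irrefl _ hu⟩

theorem frequently_one_lt_norm {w : ℂ} (hw : ‖w‖ = 1) : ∃ᶠ u in 𝓝[≠] w, u ∈ {u : ℂ | 1 < ‖u‖} := by
  have h : w ∈ closure (Metric.closedBall (0 : ℂ) 1)ᶜ := by
    rw [closure_compl, interior_closedBall _ one_ne_zero]; simp [hw]
  rw [← mem_closure_ne_iff_frequently_within]
  refine closure_mono (fun u hu => ?_) h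
  rw [Set.mem_compl_iff, mem_closedBall_zero_iff, not_le] at hu
  exact ⟨hu, fun h => by rw [Set.mem_singleton_iff] at h; rw [h, hw] at hu; exact lt_irrefl _ hu⟩

/-- Roots of unity are the values of `exp (2πis)` at rational `s`. The rationals accumulate at every
real `t`, and the nonzero derivative keeps nearby values different from the value at `t`. -/
theorem frequently_root_of_unity {w : ℂ} (hw : ‖w‖ = 1) :
    ∃ᶠ u in 𝓝[≠] w, u ∈ {u : ℂ | ∃ n > 0, u ^ n = 1} := by
  obtain ⟨t, ht⟩ : ∃ t : ℝ, Complex.exp (t * (2 * Real.pi * Complex.I)) = w := by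
    refine ⟨w.arg / (2 * Real.pi), ?_⟩
    have := Complex.norm_mul_exp_arg_mul_I w
    rw [hw, Complex.ofReal_one, one_mul] at this
    refine Eq.trans ?_ this
    congr 1
    have : (Real.pi : ℂ) ≠ 0 := by exact_mod_cast Real.pi_ne_zero
    push_cast
    field_simp
  set e : ℝ → ℂ := fun s => Complex.exp (s * (2 * Real.pi * Complex.I))
  have he : HasDerivAt e (w * (2 * Real.pi * Complex.I)) t := by
    have h1 : HasDerivAt (fun s : ℝ => (s : ℂ) * (2 * Real.pi * Complex.I))
        (1 * (2 * Real.pi * Complex.I)) t := (Complex.ofRealCLM.hasDerivAt).mul_const _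
    have := h1.cexp
    rwa [ht, one_mul] at this
  have hne : w * (2 * Real.pi * Complex.I) ≠ 0 := by
    have : w ≠ 0 := fun h => by simp [h] at hw
    have : (Real.pi : ℂ) ≠ 0 := by exact_mod_cast Real.pi_ne_zero
    simp_all
  have htend : Tendsto e (𝓝[≠] t) (𝓝[≠] w) := by
    have := he.tendsto_nhdsNE hne
    rwa [show e t = w from ht] at this
  have hfreq : ∃ᶠ s in 𝓝[≠] t, s ∈ Set.range ((↑) : ℚ → ℝ) := by
    rw [← mem_closure_ne_iff_frequently_within]
    exact (Rat.denseRange_cast.sdiff_singleton t) t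
  refine htend.frequently (hfreq.mono ?_)
  rintro _ ⟨q, rfl⟩
  refine ⟨q.den, q.den_pos, ?_⟩
  rw [← Complex.exp_nat_mul, Complex.exp_eq_one_iff]
  refine ⟨q.num, ?_⟩
  have h : (q.den : ℂ) * ((q : ℝ) : ℂ) = q.num := by
    rw [Complex.ofReal_ratCast]; exact_mod_cast Rat.den_mul_eq_num q
  rw [← mul_assoc, h]

/-! ### Chaos of the adjoint and unimodular values of the symbol -/

section Characterization

variable {φ ψ : HardyInfty}

theorem dense_nullOrbits_adjoint_mulOp (hc : ¬ ∃ c, ∀ z, φ.1 z = c) {z₀ : 𝔻}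
    (hz₀ : ‖φ.1 z₀‖ = 1) : Dense (nullOrbits (adjoint (mulOp φ)) : Set HardySpace) :=
  dense_of_kernel_mem φ.2.1 hc (frequently_norm_lt_one hz₀) fun z hz =>
    eigenvector_mem_nullOrbits (adjoint_mulOp_kernel φ z) (by simpa using hz)

theorem adjoint_mulOp_mul_eq_one (h : φ * ψ = 1) :
    adjoint (mulOp φ) * adjoint (mulOp ψ) = 1 := by
  rw [← adjoint_mulOp_mul, h, adjoint_mulOp_one]

theorem norm_mul_norm_eq_one (h : φ * ψ = 1) (z : 𝔻) : ‖φ.1 z‖ * ‖ψ.1 z‖ = 1 := by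
  have : φ.1 z * ψ.1 z = 1 := congrFun (congrArg Subtype.val h) z
  rw [← norm_mul, this, norm_one]

theorem exists_one_lt_norm (hc : ¬ ∃ c, ∀ z, φ.1 z = c) {z₀ : 𝔻} (hz₀ : ‖φ.1 z₀‖ = 1) :
    ∃ z, 1 < ‖φ.1 z‖ := by
  by_contra! h
  -- If no value has modulus above 1, the membership condition is vacuous, so even the zero subspace
  -- would be dense in a nontrivial space.
  have hd := dense_of_kernel_mem (K := ⊥) φ.2.1 hc (frequently_one_lt_norm hz₀)
    fun z hz => absurd hz (h z).not_gt
  obtain ⟨x, hx⟩ := exists_ne (0 : HardySpace)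
  have := hd.closure_eq
  rw [Submodule.bot_coe, closure_singleton] at this
  exact hx (by simpa using this.symm.subset (Set.mem_univ x))

theorem norm_le_or_le_norm_adjoint_mulOp (h : φ * ψ = 1) (hφ : ∀ z, ‖φ.1 z‖ ≠ 1) :
    (∀ x, ‖adjoint (mulOp φ) x‖ ≤ ‖x‖) ∨ ∀ x, ‖x‖ ≤ ‖adjoint (mulOp φ) x‖ := by
  refine (forall_norm_le_one_or_one_le φ.2.1 hφ).imp norm_adjoint_mulOp_apply_le fun h1 x => ?_
  -- When `|φ| ≥ 1`, the inverse operator is a contraction; applying it to the image of `x` shows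
  -- that `M_φ^*` is expansive.
  have hψ : ∀ z, ‖ψ.1 z‖ ≤ 1 := fun z => by
    nlinarith [norm_mul_norm_eq_one h z, h1 z, norm_nonneg (ψ.1 z)]
  have h2 := norm_adjoint_mulOp_apply_le hψ (adjoint (mulOp φ) x)
  rwa [← mul_apply_eq_comp, adjoint_mulOp_mul_eq_one ((mul_comm ψ φ).trans h),
    one_apply_eq_self] at h2

theorem exists_norm_eq_one_of_liYorkeChaotic (h : φ * ψ = 1)
    (hT : LiYorkeChaotic (adjoint (mulOp φ))) : ∃ z, ‖φ.1 z‖ = 1 := by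
  by_contra! hφ
  rcases norm_le_or_le_norm_adjoint_mulOp h hφ with h1 | h1
  exacts [not_liYorkeChaotic_of_norm_le h1 hT, not_liYorkeChaotic_of_le_norm h1 hT]

theorem exists_norm_eq_one_of_topTransitive (h : φ * ψ = 1)
    (hT : TopTransitive (adjoint (mulOp φ))) : ∃ z, ‖φ.1 z‖ = 1 := by
  by_contra! hφ
  rcases norm_le_or_le_norm_adjoint_mulOp h hφ with h1 | h1
  exacts [not_topTransitive_of_norm_le h1 hT, not_topTransitive_of_le_norm h1 hT]

theorem distributionallyChaotic_adjoint_mulOp (hc : ¬ ∃ c, ∀ z, φ.1 z = c)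
    (hφ : ∃ z, ‖φ.1 z‖ = 1) : DistributionallyChaotic (adjoint (mulOp φ)) := by
  obtain ⟨z₀, hz₀⟩ := hφ
  obtain ⟨z, hz⟩ := exists_one_lt_norm hc hz₀
  exact distributionallyChaotic_of_dense_nullOrbits (dense_nullOrbits_adjoint_mulOp hc hz₀)
    (kernel_ne_zero z) (adjoint_mulOp_kernel φ z) (by simpa using hz)

theorem stronglyMixing_adjoint_mulOp (h : φ * ψ = 1) (hc : ¬ ∃ c, ∀ z, φ.1 z = c)
    (hφ : ∃ z, ‖φ.1 z‖ = 1) : StronglyMixing (adjoint (mulOp φ)) := by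
  obtain ⟨z₀, hz₀⟩ := hφ
  have h' : ψ * φ = 1 := (mul_comm ψ φ).trans h
  refine stronglyMixing_of_dense_nullOrbits (adjoint_mulOp_mul_eq_one h)
    (adjoint_mulOp_mul_eq_one h') (dense_nullOrbits_adjoint_mulOp hc hz₀) ?_
  -- The kernels are eigenvectors of the inverse as well, and those with `|φ(z)| > 1` have `|ψ(z)| <
  -- 1`, hence null orbits under it.
  refine dense_of_kernel_mem φ.2.1 hc (frequently_one_lt_norm hz₀) fun z hz =>
    eigenvector_mem_nullOrbits (adjoint_mulOp_kernel ψ z) ?_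
  rw [RCLike.norm_conj]
  have hz' : 1 < ‖φ.1 z‖ := hz
  nlinarith [norm_mul_norm_eq_one h z, norm_nonneg (ψ.1 z)]

theorem devaneyChaotic_adjoint_mulOp (h : φ * ψ = 1) (hc : ¬ ∃ c, ∀ z, φ.1 z = c)
    (hφ : ∃ z, ‖φ.1 z‖ = 1) : DevaneyChaotic (adjoint (mulOp φ)) := by
  refine ⟨(stronglyMixing_adjoint_mulOp h hc hφ).topTransitive, ?_, ?_⟩
  · obtain ⟨z₀, hz₀⟩ := hφ
    refine (dense_of_kernel_mem φ.2.1 hc (frequently_root_of_unity hz₀) fun z hz => ?_).mono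
      (periodicSubmodule_subset _)
    obtain ⟨n, hn, hzn⟩ := hz
    exact eigenvector_mem_periodicSubmodule (adjoint_mulOp_kernel φ z) hn
      (by rw [← map_pow, hzn, map_one])
  · obtain ⟨z₀, hz₀⟩ := hφ
    obtain ⟨z, hz⟩ := exists_one_lt_norm hc hz₀
    exact sensitive_of_eigenvector (kernel_ne_zero z) (adjoint_mulOp_kernel φ z) (by simpa using hz)

/-- For an invertible nonconstant symbol, each of the four kinds of chaos of the adjoint means that
the symbol attains a unimodular value. -/
theorem chaos_adjoint_mulOp_iff (h : φ * ψ = 1) (hc : ¬ ∃ c, ∀ z, φ.1 z = c) :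
    (DevaneyChaotic (adjoint (mulOp φ)) ↔ ∃ z, ‖φ.1 z‖ = 1) ∧
    (DistributionallyChaotic (adjoint (mulOp φ)) ↔ ∃ z, ‖φ.1 z‖ = 1) ∧
    (StronglyMixing (adjoint (mulOp φ)) ↔ ∃ z, ‖φ.1 z‖ = 1) ∧
    (LiYorkeChaotic (adjoint (mulOp φ)) ↔ ∃ z, ‖φ.1 z‖ = 1) :=
  ⟨⟨fun hT => exists_norm_eq_one_of_topTransitive h hT.transitive,
      devaneyChaotic_adjoint_mulOp h hc⟩,
    ⟨fun hT => exists_norm_eq_one_of_liYorkeChaotic h hT.liYorkeChaotic,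
      distributionallyChaotic_adjoint_mulOp hc⟩,
    ⟨fun hT => exists_norm_eq_one_of_topTransitive h hT.topTransitive,
      stronglyMixing_adjoint_mulOp h hc⟩,
    ⟨exists_norm_eq_one_of_liYorkeChaotic h,
      fun hφ => (distributionallyChaotic_adjoint_mulOp hc hφ).liYorkeChaotic⟩⟩

/-- A constant symbol would make the open set `Ω` a single point. -/
theorem IsCowenDouglasFunction.not_const (hφ : IsCowenDouglasFunction φ) :
    ¬ ∃ c, ∀ z, φ.1 z = c := by
  rintro ⟨c, hc⟩
  obtain ⟨n, hn⟩ := hφ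
  have : (Set.range fun z : 𝔻 => conj (φ.1 z)) = {conj c} := by
    simp only [hc]
    exact Set.range_const
  exact not_isOpen_singleton _ (this ▸ hn.isOpen)

end Characterization

end

theorem corollary5 (φ : HardyInfty) (hφ : IsCowenDouglasFunction φ) (hinv : IsUnit φ) :
    IsUnit (ContinuousLinearMap.adjoint (mulOp φ)) ∧
    (DevaneyChaotic (ContinuousLinearMap.adjoint (mulOp φ)) ↔
      DevaneyChaotic (Ring.inverse (ContinuousLinearMap.adjoint (mulOp φ)))) ∧
    (DistributionallyChaotic (ContinuousLinearMap.adjoint (mulOp φ)) ↔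
      DistributionallyChaotic (Ring.inverse (ContinuousLinearMap.adjoint (mulOp φ)))) ∧
    (StronglyMixing (ContinuousLinearMap.adjoint (mulOp φ)) ↔
      StronglyMixing (Ring.inverse (ContinuousLinearMap.adjoint (mulOp φ)))) ∧
    (LiYorkeChaotic (ContinuousLinearMap.adjoint (mulOp φ)) ↔
      LiYorkeChaotic (Ring.inverse (ContinuousLinearMap.adjoint (mulOp φ)))) := by
  obtain ⟨ψ, h⟩ := hinv.exists_right_inv
  have h' : ψ * φ = 1 := (mul_comm ψ φ).trans h
  have hc := hφ.not_const
  have hψc : ¬ ∃ c, ∀ z, ψ.1 z = c := by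
    rintro ⟨c, hψ⟩
    refine hc ⟨c⁻¹, fun z => eq_inv_of_mul_eq_one_left ?_⟩
    rw [← hψ z]
    exact congrFun (congrArg Subtype.val h) z
  have hTS := adjoint_mulOp_mul_eq_one h
  have hST := adjoint_mulOp_mul_eq_one h'
  -- `Ring.inverse` is zero on non-units; the two product identities show that here it is the
  -- genuine inverse.
  have hinverse : Ring.inverse (ContinuousLinearMap.adjoint (mulOp φ))
      = ContinuousLinearMap.adjoint (mulOp ψ) := by
    exact Ring.inverse_unit (⟨_, _, hTS, hST⟩ : (HardySpace →L[ℂ] HardySpace)ˣ)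
  have hiff : (∃ z, ‖φ.1 z‖ = 1) ↔ ∃ z, ‖ψ.1 z‖ = 1 := by
    refine exists_congr fun z => ⟨fun hz => ?_, fun hz => ?_⟩
    · simpa [hz] using norm_mul_norm_eq_one h z
    · simpa [hz] using norm_mul_norm_eq_one h z
  obtain ⟨a1, a2, a3, a4⟩ := chaos_adjoint_mulOp_iff h hc
  obtain ⟨b1, b2, b3, b4⟩ := chaos_adjoint_mulOp_iff h' hψc
  rw [hinverse]
  exact ⟨⟨⟨_, _, hTS, hST⟩, rfl⟩, a1.trans (hiff.trans b1.symm), a2.trans (hiff.trans b2.symm),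
    a3.trans (hiff.trans b3.symm), a4.trans (hiff.trans b4.symm)⟩
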